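/- Let $c_0,c_1\in(0,1)$. For $n\ge 1$ let $\mathrm{Comp}(c_0,c_1)$ be the set of unit vectors $v\in\mathbb{R}^n$ within Euclidean distance $c_1$ of some $w\in\mathbb{R}^n$ with at most $c_0n$ nonzero coordinates, and let $\mathrm{Incomp}(c_0,c_1)=\mathbb{S}^{n-1}\setminus\mathrm{Comp}(c_0,c_1)$. Call a coordinate $k$ of $v$ spread if $\frac{c_1}{\sqrt{2n}}\le|v_k|\le\frac{1}{\sqrt{c_0n}}$. Fix $c\in(0,1/5)$, depending only on $c_0,c_1$, such that for all sufficiently large $n$ every $v\in\mathrm{Incomp}(c_0,c_1)$ has at least $2\lceil cn\rceil$ spread coordinates (such a $c$ exists). To every $v\in\mathrm{Incomp}(c_0,c_1)$ assign a set $\mathrm{Spread}(v)\subseteq[n]$ of exactly $\lceil cn\rceil$ spread coordinates of $v$. For $\lambda\in(0,c/2)$ let $T=\lfloor\lceil cn\rceil/\lceil\lambda n\rceil\rfloor$ and choose pairwise disjoint subsets $\mathrm{Spread}^1_\lambda(v),\dots,\mathrm{Spread}^T_\lambda(v)$ of $\mathrm{Spread}(v)$, each of size $\lceil\lambda n\rceil$,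 the choice depending on $v$ only through $\mathrm{Spread}(v)$. For $L\ge1$ and a unit vector $x\in\mathbb{R}^N$ put \[D_L(x)=\inf\{\theta>0:\ \mathrm{dist}(\theta x,\mathbb{Z}^N)<L\sqrt{\log_+(\theta/L)}\},\qquad \log_+ t=\max(\log t,0),\] and let $\widehat{MD}_L(v,\lambda)$ be the median of the multiset of the $T$ numbers $D_L(v_I/\|v_I\|_2)$, $I=\mathrm{Spread}^j_\lambda(v)$, $1\le j\le T$, where $v_I$ is the restriction of $v$ to the coordinates in $I$ (if $T$ is even, the median is the larger of the two middle values). For $D\ge1$ let \[S_D=\{v\in\mathrm{Incomp}(c_0,c_1):\ \widehat{MD}_L(v,\lambda)\in[D,2D]\}.\] Proposition. There exists $C>0$, depending only on $c_0,c_1$ (and on the constant $c$ fixed in terms of them), such that for all $n\ge1$, all $\lambda\in(C/n,\,c/2)$, all choices of the sets $\mathrm{Spread}(v)$ and $\mathrm{Spread}^j_\lambda(v)$ as above, all $L\ge1$ and all $D\ge1$, there is a finite set $\mathcal{N}\subset\mathbb{R}^n$ such that every point of $S_D$ is within Euclidean distance \[\beta=\frac{L\sqrt{\log(2D)}}{D}\]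 of a point of $\mathcal{N}$, and \[|\mathcal{N}|\le D^{1/\lambda}\left(\frac{CD}{\sqrt{\log(2D)}}\right)^{n}\left(\frac{\sqrt{\log(2D)}}{\sqrt{\lambda n}}\right)^{cn/8}.\] -/

import Mathlib

open Finset

noncomputable section

namespace MRLCD

/-- Compressible unit vectors: those within Euclidean distance `c₁` of a vector with at most
`c₀ n` non-zero coordinates. -/
def Comp (n : ℕ) (c₀ c₁ : ℝ) : Set (EuclideanSpace ℝ (Fin n)) :=
  {v | ‖v‖ = 1 ∧ ∃ w : EuclideanSpace ℝ (Fin n),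
    (#{i | w i ≠ 0} : ℝ) ≤ c₀ * n ∧ dist v w ≤ c₁}

/-- Incompressible vectors: the unit vectors that are not compressible. -/
def Incomp (n : ℕ) (c₀ c₁ : ℝ) : Set (EuclideanSpace ℝ (Fin n)) :=
  Metric.sphere 0 1 \ Comp n c₀ c₁

/-- The coordinate `k` of `v` is spread: `c₁ / √(2n) ≤ |v_k| ≤ 1 / √(c₀ n)`. -/
def IsSpreadCoord {n : ℕ} (c₀ c₁ : ℝ) (v : EuclideanSpace ℝ (Fin n)) (k : Fin n) : Prop :=
  c₁ / √(2 * n) ≤ |v k| ∧ |v k| ≤ 1 / √(c₀ * n)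

open Classical in
/-- `c` is an admissible spread constant for `c₀, c₁`: it lies in `(0, 1/5)` and, in every large
enough dimension `n`, each incompressible vector has at least `2⌈cn⌉` spread coordinates. -/
def IsSpreadConstant (c₀ c₁ c : ℝ) : Prop :=
  0 < c ∧ c < 1 / 5 ∧ ∃ n₀ : ℕ, ∀ n ≥ n₀, ∀ v ∈ Incomp n c₀ c₁,
    2 * ⌈c * n⌉₊ ≤ #{k | IsSpreadCoord c₀ c₁ v k}

/-- `spread` assigns to every incompressible `v` a set `Spread(v)` of exactly `⌈cn⌉` spread
coordinates. -/
def IsSpreadAssignment (n : ℕ) (c₀ c₁ c : ℝ)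
    (spread : EuclideanSpace ℝ (Fin n) → Finset (Fin n)) : Prop :=
  ∀ v ∈ Incomp n c₀ c₁, #(spread v) = ⌈c * n⌉₊ ∧ ∀ k ∈ spread v, IsSpreadCoord c₀ c₁ v k

/-- The number of blocks: `⌈lam n⌉` times this number is the largest multiple of `⌈lam n⌉` that is
at most `⌈cn⌉`. -/
def numBlocks (n : ℕ) (c lam : ℝ) : ℕ := ⌈c * n⌉₊ / ⌈lam * n⌉₊

/-- `block` assigns to every possible spread set `S` (a set of `⌈cn⌉` indices) pairwise disjoint
subsets `block S j ⊆ S` of size `⌈lam n⌉`. The sets `block (spread v) j` are the parts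
`Spread_lam^j(v)`, and their union is `Spread_lam(v)`; they depend on `v` through `spread v`
only. -/
def IsBlockAssignment (n : ℕ) (c lam : ℝ)
    (block : Finset (Fin n) → Fin (numBlocks n c lam) → Finset (Fin n)) : Prop :=
  ∀ S : Finset (Fin n), #S = ⌈c * n⌉₊ →
    (∀ j, block S j ⊆ S ∧ #(block S j) = ⌈lam * n⌉₊) ∧
    Pairwise fun i j => Disjoint (block S i) (block S j)

/-- The integer lattice in `ℝ^ι`. -/
def integerPoints (ι : Type*) : Set (EuclideanSpace ℝ ι) :=
  {x | ∀ i, ∃ m : ℤ, x i = m}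

/-- The (log-normalized) least common denominator
`D_L(x) = inf {θ > 0 : dist (θ x, ℤ^ι) < L √(log₊ (θ / L))}`. -/
def lcd {ι : Type*} [Fintype ι] (L : ℝ) (x : EuclideanSpace ℝ ι) : ℝ :=
  sInf {θ : ℝ | 0 < θ ∧ Metric.infDist (θ • x) (integerPoints ι) < L * √(Real.posLog (θ / L))}

/-- The vector `v_I / ‖v_I‖₂`, where `v_I` retains only the coordinates of `v` in `I`. -/
def normalizedRestrict {n : ℕ} (v : EuclideanSpace ℝ (Fin n)) (I : Finset (Fin n)) :
    EuclideanSpace ℝ I :=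
  let w : EuclideanSpace ℝ I := WithLp.toLp 2 fun i : I => v i
  ‖w‖⁻¹ • w

/-- The median of a finite non-empty multiset of reals; for an even number of elements it is the
larger of the two middle values. -/
def upperMedian (s : Multiset ℝ) : ℝ :=
  (s.sort (· ≤ ·)).getD (s.card / 2) 0

/-- The median regularized LCD of `v`. -/
def mrlcd {n m : ℕ} (spread : EuclideanSpace ℝ (Fin n) → Finset (Fin n))
    (block : Finset (Fin n) → Fin m → Finset (Fin n)) (L : ℝ)
    (v : EuclideanSpace ℝ (Fin n)) : ℝ :=
  upperMedian ((Finset.univ : Finset (Fin m)).val.map fun j =>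
    lcd L (normalizedRestrict v (block (spread v) j)))

/-- The level set `S_D`: incompressible vectors whose median regularized LCD is in `[D, 2D]`. -/
def levelSet {n m : ℕ} (c₀ c₁ : ℝ) (spread : EuclideanSpace ℝ (Fin n) → Finset (Fin n))
    (block : Finset (Fin n) → Fin m → Finset (Fin n)) (L D : ℝ) :
    Set (EuclideanSpace ℝ (Fin n)) :=
  {v ∈ Incomp n c₀ c₁ | mrlcd spread block L v ∈ Set.Icc D (2 * D)}

/-- `N` is a `β`-net of `S`: every point of `S` is within distance `β` of a point of `N`. -/
def IsNet {n : ℕ} (β : ℝ) (S : Set (EuclideanSpace ℝ (Fin n)))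
    (N : Finset (EuclideanSpace ℝ (Fin n))) : Prop :=
  ∀ v ∈ S, ∃ w ∈ N, dist v w ≤ β

/-- Spread constants exist. -/
theorem exists_isSpreadConstant (c₀ c₁ : ℝ) (hc₀ : c₀ ∈ Set.Ioo (0 : ℝ) 1)
    (hc₁ : c₁ ∈ Set.Ioo (0 : ℝ) 1) : ∃ c, IsSpreadConstant c₀ c₁ c := by
  classical
  obtain ⟨h0, h0'⟩ := hc₀
  obtain ⟨h1, h1'⟩ := hc₁
  have hp : 0 < c₀ * c₁ ^ 2 := by positivity
  have hp1 : c₀ * c₁ ^ 2 < 1 := by nlinarith [sq_nonneg c₁]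
  obtain ⟨n₀, hn₀⟩ := exists_nat_gt (8 / (c₀ * c₁ ^ 2))
  refine ⟨c₀ * c₁ ^ 2 / 8, by positivity, by linarith, n₀, ?_⟩
  intro n hn v hv
  have hn' : (8 : ℝ) < n * (c₀ * c₁ ^ 2) := by
    have : 8 / (c₀ * c₁ ^ 2) < (n : ℝ) := hn₀.trans_le (by exact_mod_cast hn)
    exact (div_lt_iff₀ hp).1 this
  have hnpos : (0 : ℝ) < n := by
    by_contra h
    nlinarith
  obtain ⟨hv1, hv2⟩ := hv
  have hv1 : ‖v‖ = 1 := by simpa using hv1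
  have hsum : ∑ k, v k ^ 2 = 1 := by
    have := EuclideanSpace.real_norm_sq_eq v
    rw [hv1] at this
    linarith
  set A : Finset (Fin n) := {k | 1 / √(c₀ * n) < |v k|} with hA
  set σ : Finset (Fin n) := {k | IsSpreadCoord c₀ c₁ v k} with hσ
  have hcn : 0 < c₀ * n := by positivity
  have hAcard : (#A : ℝ) ≤ c₀ * n := by
    have h : ∑ k ∈ A, 1 / (c₀ * n) ≤ ∑ k ∈ A, v k ^ 2 := by
      refine Finset.sum_le_sum fun k hk => ?_
      have hk : 1 / √(c₀ * n) < |v k| := by simpa [hA] using hk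
      have : (1 / √(c₀ * n)) ^ 2 ≤ |v k| ^ 2 := by gcongr
      rwa [div_pow, one_pow, Real.sq_sqrt hcn.le, sq_abs] at this
    have h2 : ∑ k ∈ A, v k ^ 2 ≤ 1 := by
      rw [← hsum]
      exact Finset.sum_le_sum_of_subset_of_nonneg (Finset.subset_univ _)
        fun _ _ _ => sq_nonneg _
    rw [Finset.sum_const, nsmul_eq_mul] at h
    have h3 := h.trans h2
    rw [mul_one_div, div_le_one hcn] at h3
    exact h3
  have hdist : c₁ ^ 2 < ∑ k, if k ∈ A then 0 else v k ^ 2 := by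
    set w : EuclideanSpace ℝ (Fin n) := WithLp.toLp 2 fun k => if k ∈ A then v k else 0 with hw
    have hlt : c₁ < dist v w := by
      by_contra hcon
      refine hv2 ⟨hv1, w, le_trans ?_ hAcard, not_lt.1 hcon⟩
      have : #{i | w i ≠ 0} ≤ #A := Finset.card_le_card fun k hk => by
        by_contra hkA
        simp [hw, hkA] at hk
      exact_mod_cast this
    have : dist v w ^ 2 = ∑ k, if k ∈ A then 0 else v k ^ 2 := by
      rw [dist_eq_norm, EuclideanSpace.real_norm_sq_eq]
      refine Finset.sum_congr rfl fun k _ => ?_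
      by_cases hk : k ∈ A <;> simp [hw, hk]
    rw [← this]
    gcongr
  have hbound : ∀ k, (if k ∈ A then 0 else v k ^ 2) ≤
      (if k ∈ σ then 1 / (c₀ * n) else 0) + c₁ ^ 2 / (2 * n) := by
    intro k
    have hpos : 0 ≤ c₁ ^ 2 / (2 * n) := by positivity
    have hpos' : 0 ≤ 1 / (c₀ * n) := by positivity
    by_cases hk : k ∈ A
    · simp only [hk, if_true]
      split_ifs <;> linarith
    have hk' : |v k| ≤ 1 / √(c₀ * n) := by simpa [hA] using hk
    simp only [hk, if_false]
    by_cases hs : k ∈ σ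
    · simp only [hs, if_true]
      have : |v k| ^ 2 ≤ (1 / √(c₀ * n)) ^ 2 := by gcongr
      rw [div_pow, one_pow, Real.sq_sqrt hcn.le, sq_abs] at this
      linarith
    · simp only [hs, if_false]
      have hlt : |v k| < c₁ / √(2 * n) := by
        by_contra hge
        exact hs (by simpa [hσ] using ⟨not_lt.1 hge, hk'⟩)
      have : |v k| ^ 2 ≤ (c₁ / √(2 * n)) ^ 2 := by gcongr
      rw [div_pow, Real.sq_sqrt (by positivity), sq_abs] at this
      linarith
  have hfin := hdist.trans_le (Finset.sum_le_sum fun k _ => hbound k)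
  rw [Finset.sum_add_distrib, Finset.sum_const, Finset.card_univ, Fintype.card_fin,
    Finset.sum_ite_mem, Finset.univ_inter, Finset.sum_const, nsmul_eq_mul, nsmul_eq_mul] at hfin
  have e1 : (n : ℝ) * (c₁ ^ 2 / (2 * n)) = c₁ ^ 2 / 2 := by field_simp
  rw [e1, mul_one_div] at hfin
  have hσcard : c₁ ^ 2 / 2 * (c₀ * n) < #σ := by
    rw [← lt_div_iff₀ hcn]
    linarith
  have hceil := Nat.ceil_lt_add_one (a := c₀ * c₁ ^ 2 / 8 * n) (by positivity)
  have : (2 * ⌈c₀ * c₁ ^ 2 / 8 * n⌉₊ : ℝ) ≤ #σ := by nlinarith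
  exact_mod_cast this

/-- Spread assignments exist in all large dimensions. -/
theorem exists_isSpreadAssignment (c₀ c₁ c : ℝ) (hc : IsSpreadConstant c₀ c₁ c) :
    ∃ n₀ : ℕ, ∀ n ≥ n₀, ∃ spread, IsSpreadAssignment n c₀ c₁ c spread := by
  classical
  obtain ⟨-, -, n₀, h⟩ := hc
  refine ⟨n₀, fun n hn => ?_⟩
  have : ∀ v : EuclideanSpace ℝ (Fin n), ∃ S : Finset (Fin n), v ∈ Incomp n c₀ c₁ →
      #S = ⌈c * n⌉₊ ∧ ∀ k ∈ S, IsSpreadCoord c₀ c₁ v k := by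
    intro v
    by_cases hv : v ∈ Incomp n c₀ c₁
    · obtain ⟨S, hS, hcard⟩ := Finset.exists_subset_card_eq
        (show ⌈c * n⌉₊ ≤ #{k | IsSpreadCoord c₀ c₁ v k} by have := h n hn v hv; omega)
      exact ⟨S, fun _ => ⟨hcard, fun k hk => by simpa using hS hk⟩⟩
    · exact ⟨∅, fun hv' => absurd hv' hv⟩
  choose s hs using this
  exact ⟨s, hs⟩

/-- Block assignments exist. -/
theorem exists_isBlockAssignment (n : ℕ) (c lam : ℝ) :
    ∃ block, IsBlockAssignment n c lam block := by
  classical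
  set r := ⌈lam * n⌉₊ with hr
  have : ∀ S : Finset (Fin n), ∃ b : Fin (numBlocks n c lam) → Finset (Fin n),
      #S = ⌈c * n⌉₊ → (∀ j, b j ⊆ S ∧ #(b j) = r) ∧ Pairwise fun i j => Disjoint (b i) (b j) := by
    intro S
    by_cases hS : #S = ⌈c * n⌉₊
    · have hle : numBlocks n c lam * r ≤ #S := by
        rw [hS]
        exact Nat.div_mul_le_self _ _
      have e := S.equivFin.symm
      let g : Fin (numBlocks n c lam) × Fin r ↪ Fin n :=
        ((finProdFinEquiv.toEmbedding.trans (Fin.castLEEmb hle)).trans e.toEmbedding).trans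
          (Function.Embedding.subtype _)
      have hg : ∀ p, g p ∈ S := fun p => Subtype.prop _
      refine ⟨fun j => Finset.univ.map ((Function.Embedding.sectR j (Fin r)).trans g),
        fun _ => ⟨fun j => ⟨?_, by simp⟩, fun i j hij => ?_⟩⟩
      · intro k hk
        obtain ⟨a, -, rfl⟩ := Finset.mem_map.1 hk
        exact hg _
      · refine Finset.disjoint_left.2 ?_
        intro k hk hk'
        obtain ⟨a, -, rfl⟩ := Finset.mem_map.1 hk
        obtain ⟨b, -, hb⟩ := Finset.mem_map.1 hk'
        have := g.injective hb
        exact hij (congrArg Prod.fst this).symm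
    · exact ⟨fun _ => ∅, fun h => absurd h hS⟩
  choose b hb using this
  exact ⟨b, hb⟩

end MRLCD

end

namespace MRLCD

/-! If a block v_I has D_L(v_I/‖v_I‖) ≤ 2D, some θ < 3D brings θ v_I/‖v_I‖ close to an integer point
p, so v_I = s(p + e) with s = ‖v_I‖/θ and ‖e‖ ≤ 2βD (`exists_repr_of_lcd_le`). Spread coordinates
are comparable to each other, which forces θ ≥ a√|I| for a constant a; hence p takes at most
(Cθ/√|I|)^|I| values (`exists_finset_int_of_sum_abs_le`). Resolving e to the needed accuracy takes
(CD/θ)^|I| values, so θ cancels. Adding O(D) scales for θ and O(D) values of s, the block costs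
D²(CD/√|I|)^|I| (`exists_lattice_net`). A plain grid costs (CD/√log(2D))^|I|, so such a block gains
(√log(2D)/√|I|)^|I|.

By the choice of median, more than half of the T blocks are of this kind. Some m = ⌊T/2⌋ + 1 of them
cover at least cn/2 coordinates, and m ≤ 1/(2λ), so the factors D² multiply to at most D^(1/λ). The
other coordinates use a plain grid, and a union over the spread set and the set of good blocks costs
at most 4^n (`exists_net_of_good_blocks`). When √log(2D)/√(λn) ≥ 1 there is nothing to gain and the
grid alone suffices. -/

/-! ### Counting integer vectors in ℓ¹ balls. -/

theorem sum_Icc_pow_natAbs_le (t : ℝ) (ht : 0 ≤ t) (ht1 : t < 1) (B : ℕ) :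
    ∑ k ∈ Icc (-(B : ℤ)) B, t ^ k.natAbs ≤ 1 + 2 * (t / (1 - t)) := by
  have h1 : 0 < 1 - t := by linarith
  have key : ∑ k ∈ Icc (-(B : ℤ)) B, t ^ k.natAbs =
      1 + 2 * (t * (1 - t ^ B) / (1 - t)) := by
    induction B with
    | zero => simp
    | succ B ih =>
      have e : Icc (-((B + 1 : ℕ) : ℤ)) ((B + 1 : ℕ) : ℤ) =
          insert (-((B + 1 : ℕ) : ℤ)) (insert ((B + 1 : ℕ) : ℤ) (Icc (-(B : ℤ)) B)) := by
        ext k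
        simp only [mem_Icc, mem_insert]
        omega
      rw [e, sum_insert (by simp only [mem_insert, mem_Icc]; omega),
        sum_insert (by simp only [mem_Icc]; omega), ih]
      simp only [Int.natAbs_neg, Int.natAbs_natCast]
      field_simp
      ring
  rw [key]
  have : t * (1 - t ^ B) ≤ t := by nlinarith [pow_nonneg ht B]
  gcongr

/-- The number of integer vectors of bounded `ℓ¹` norm. -/
theorem exists_finset_int_of_sum_abs_le (ι : Type*) [Fintype ι] (K ρ : ℝ) (hρ : 0 < ρ) :
    ∃ F : Finset (ι → ℤ), (∀ z : ι → ℤ, ∑ i, |(z i : ℝ)| ≤ K * ρ → z ∈ F) ∧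
      (#F : ℝ) ≤ Real.exp K * (1 + 2 * ρ) ^ Fintype.card ι := by
  classical
  set B : ℕ := ⌈K * ρ⌉₊
  set G : Finset (ι → ℤ) := Fintype.piFinset fun _ => Icc (-(B : ℤ)) B
  refine ⟨{z ∈ G | ∑ i, |(z i : ℝ)| ≤ K * ρ}, ?_, ?_⟩
  · intro z hz
    refine mem_filter.2 ⟨Fintype.mem_piFinset.2 fun i => ?_, hz⟩
    have h : |(z i : ℝ)| ≤ B :=
      ((single_le_sum (f := fun i => |(z i : ℝ)|) (fun i _ => abs_nonneg _) (mem_univ i)).trans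
        hz).trans (Nat.le_ceil _)
    have h' : |z i| ≤ (B : ℤ) := by exact_mod_cast h
    exact mem_Icc.2 (abs_le.1 h')
  -- Exponential-moment count: an admissible z has weight exp(K - ‖z‖₁/ρ) ≥ 1, and the total weight
  -- over the box factors into one geometric sum per coordinate. This t satisfies t/(1 - t) ≤ ρ.
  set t : ℝ := Real.exp (-(1 / ρ))
  have ht : 0 < t := Real.exp_pos _
  have ht1 : t < 1 := Real.exp_lt_one_iff.2 (by simpa using hρ)
  have hexp : ∀ z : ι → ℤ, ∏ i, t ^ (z i).natAbs = Real.exp (-(∑ i, |(z i : ℝ)|) / ρ) := by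
    intro z
    have : ∀ i, t ^ (z i).natAbs = Real.exp (-|(z i : ℝ)| / ρ) := by
      intro i
      rw [← Real.exp_nat_mul, Nat.cast_natAbs, Int.cast_abs]
      congr 1
      ring
    simp_rw [this]
    rw [← Real.exp_sum]
    congr 1
    rw [← sum_div, sum_neg_distrib]
  have htρ : t / (1 - t) ≤ ρ := by
    rw [div_le_iff₀ (by linarith)]
    have h := Real.add_one_le_exp (1 / ρ)
    have h2 : Real.exp (1 / ρ) * t = 1 := by rw [← Real.exp_add]; simp
    have h3 : (1 / ρ + 1) * t ≤ 1 := by nlinarith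
    have h4 : ρ * ((1 / ρ + 1) * t) ≤ ρ * 1 := by gcongr
    have h5 : ρ * ((1 / ρ + 1) * t) = t + ρ * t := by field_simp
    linarith
  calc (#{z ∈ G | ∑ i, |(z i : ℝ)| ≤ K * ρ} : ℝ)
      = ∑ z ∈ G with ∑ i, |(z i : ℝ)| ≤ K * ρ, (1 : ℝ) := by simp
    _ ≤ ∑ z ∈ G with ∑ i, |(z i : ℝ)| ≤ K * ρ, Real.exp K * ∏ i, t ^ (z i).natAbs := by
        refine sum_le_sum fun z hz => ?_
        have hz := (mem_filter.1 hz).2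
        rw [hexp, ← Real.exp_add]
        refine Real.one_le_exp ?_
        have : (∑ i, |(z i : ℝ)|) / ρ ≤ K := by rwa [div_le_iff₀ hρ]
        rw [neg_div]
        linarith
    _ ≤ ∑ z ∈ G, Real.exp K * ∏ i, t ^ (z i).natAbs :=
        sum_le_sum_of_subset_of_nonneg (filter_subset _ _) fun _ _ _ => by positivity
    _ = Real.exp K * ∏ _i : ι, ∑ k ∈ Icc (-(B : ℤ)) B, t ^ k.natAbs := by
        rw [← mul_sum, prod_univ_sum]
    _ ≤ _ := by
        rw [prod_const, card_univ]
        have := sum_Icc_pow_natAbs_le t ht.le ht1 B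
        have h0 : 0 ≤ ∑ k ∈ Icc (-(B : ℤ)) B, t ^ k.natAbs := sum_nonneg fun _ _ => by positivity
        gcongr
        linarith

/-! ### Rounding to grids, and nets assembled block by block. -/

theorem sum_abs_le_sqrt_card_mul {ι : Type*} [Fintype ι] (f : ι → ℝ) {r : ℝ} (hr : 0 ≤ r)
    (h : ∑ i, f i ^ 2 ≤ r ^ 2) : ∑ i, |f i| ≤ √(Fintype.card ι) * r := by
  have h1 := sq_sum_le_card_mul_sum_sq (s := (univ : Finset ι)) (f := fun i => |f i|)
  simp only [sq_abs, card_univ] at h1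
  refine abs_le_of_sq_le_sq' ?_ (by positivity) |>.2
  rw [mul_pow, Real.sq_sqrt (by positivity)]
  exact h1.trans (by gcongr)

theorem abs_round_div_le (x g : ℝ) (hg : 0 < g) :
    |(round (x / g) : ℝ)| ≤ |x| / g + 1 / 2 := by
  have h := abs_sub_round (x / g)
  have h2 : |(round (x / g) : ℝ)| - |x / g| ≤ |x / g - round (x / g)| := by
    rw [abs_sub_comm]; exact abs_sub_abs_le_abs_sub _ _
  rw [abs_div, abs_of_pos hg] at h2
  linarith

theorem sq_sub_mul_round_le (x g : ℝ) (hg : 0 < g) :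
    (x - g * round (x / g)) ^ 2 ≤ g ^ 2 / 4 := by
  have h := abs_sub_round (x / g)
  have e : x - g * round (x / g) = g * (x / g - round (x / g)) := by field_simp
  rw [e, mul_pow]
  have : (x / g - round (x / g)) ^ 2 ≤ 1 / 4 := by
    have := sq_le_sq' (abs_le.1 h).1 (abs_le.1 h).2
    linarith
  nlinarith [sq_nonneg g]

/-- The coordinates in `I` of the points of `V` have a net of size at most `K`, with mean square
error `γ` per coordinate. -/
def HasNet {α : Type*} (I : Finset α) (V : Set (α → ℝ)) (γ K : ℝ) : Prop :=
  ∃ F : Finset (α → ℝ), (#F : ℝ) ≤ K ∧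
    ∀ v ∈ V, ∃ w ∈ F, ∑ i ∈ I, (v i - w i) ^ 2 ≤ γ ^ 2 * #I

/-- The permitted squared error is proportional to the number of coordinates, so over disjoint index
sets the errors add with no loss in γ while the net sizes multiply. -/
theorem HasNet.union {α : Type*} [DecidableEq α] {I J : Finset α} {V : Set (α → ℝ)} {γ K M : ℝ}
    (hIJ : Disjoint I J) (hI : HasNet I V γ K) (hJ : HasNet J V γ M) :
    HasNet (I ∪ J) V γ (K * M) := by
  classical
  obtain ⟨F, hF, hFn⟩ := hI
  obtain ⟨G, hG, hGn⟩ := hJ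
  refine ⟨image₂ (fun f g => I.piecewise f g) F G, ?_, fun v hv => ?_⟩
  · have : (#(image₂ (fun f g => I.piecewise f g) F G) : ℝ) ≤ #F * #G := by
      exact_mod_cast card_image₂_le _ _ _
    exact this.trans (mul_le_mul hF hG (by positivity) ((Nat.cast_nonneg _).trans hF))
  obtain ⟨f, hf, hf'⟩ := hFn v hv
  obtain ⟨g, hg, hg'⟩ := hGn v hv
  refine ⟨_, mem_image₂_of_mem hf hg, ?_⟩
  rw [sum_union hIJ, card_union_of_disjoint hIJ, Nat.cast_add, mul_add]
  refine add_le_add (le_trans (le_of_eq ?_) hf') (le_trans (le_of_eq ?_) hg')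
  · exact sum_congr rfl fun i hi => by rw [piecewise_eq_of_mem _ _ _ hi]
  · exact sum_congr rfl fun i hi => by
      rw [piecewise_eq_of_notMem _ _ _ (disjoint_right.1 hIJ hi)]

theorem HasNet.biUnion {α β : Type*} [DecidableEq α] {V : Set (α → ℝ)} {γ K : ℝ}
    {b : β → Finset α} (J : Finset β) (hb : Pairwise fun i j => Disjoint (b i) (b j))
    (h : ∀ j ∈ J, HasNet (b j) V γ K) : HasNet (J.biUnion b) V γ (K ^ #J) := by
  classical
  induction J using Finset.induction_on with
  | empty => exact ⟨{0}, by simp, fun v _ => ⟨0, by simp⟩⟩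
  | insert j J hj ih =>
    rw [biUnion_insert, card_insert_of_notMem hj, pow_succ, mul_comm]
    refine HasNet.union ?_ (h j (mem_insert_self _ _))
      (ih fun i hi => h i (mem_insert_of_mem hi))
    rw [disjoint_biUnion_right]
    exact fun i hi => hb fun e => hj (e ▸ hi)

theorem HasNet.of_subtype {α : Type*} {I : Finset α} {V : Set (α → ℝ)} {γ K : ℝ}
    (h : ∃ F : Finset (I → ℝ), (#F : ℝ) ≤ K ∧
      ∀ v ∈ V, ∃ w ∈ F, ∑ i : I, (v i - w i) ^ 2 ≤ γ ^ 2 * #I) : HasNet I V γ K := by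
  classical
  obtain ⟨F, hF, hFn⟩ := h
  refine ⟨F.image fun w i => if hi : i ∈ I then w ⟨i, hi⟩ else 0, ?_, fun v hv => ?_⟩
  · exact le_trans (by exact_mod_cast card_image_le) hF
  obtain ⟨w, hw, hw'⟩ := hFn v hv
  refine ⟨_, mem_image_of_mem _ hw, le_trans (le_of_eq ?_) hw'⟩
  rw [← sum_coe_sort I]
  exact sum_congr rfl fun i _ => by simp

/-- A grid net of the unit ball. -/
theorem exists_grid_net (ι : Type*) [Fintype ι] (n : ℕ) (hn : 0 < n) (hι : Fintype.card ι ≤ n)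
    (β : ℝ) (hβ : 0 < β) :
    ∃ F : Finset (ι → ℝ), (#F : ℝ) ≤ Real.exp n * (2 + 2 / β) ^ Fintype.card ι ∧
      ∀ y : ι → ℝ, ∑ i, y i ^ 2 ≤ 1 →
        ∃ w ∈ F, ∑ i, (y i - w i) ^ 2 ≤ (β / √n) ^ 2 * Fintype.card ι := by
  classical
  have hn' : (0 : ℝ) < n := by exact_mod_cast hn
  have hι' : (Fintype.card ι : ℝ) ≤ n := by exact_mod_cast hι
  set g : ℝ := β / √n with hg
  have hg0 : 0 < g := by positivity
  -- By Cauchy–Schwarz ‖y‖₁ ≤ √n, so dividing by the mesh β/√n gives n/β; the 1/2 per coordinate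
  -- comes from rounding.
  obtain ⟨Z, hZ, hZc⟩ := exists_finset_int_of_sum_abs_le ι n (1 / β + 1 / 2) (by positivity)
  refine ⟨Z.image fun z i => g * z i, ?_, fun y hy => ?_⟩
  · refine le_trans (by exact_mod_cast card_image_le) (hZc.trans (le_of_eq ?_))
    congr 2
    ring
  refine ⟨_, mem_image_of_mem _ (hZ (fun i => round (y i / g)) ?_), ?_⟩
  · have h1 : ∑ i, |y i| ≤ √(Fintype.card ι) * 1 :=
      sum_abs_le_sqrt_card_mul y zero_le_one (by simpa using hy)
    have h2 : √(Fintype.card ι : ℝ) ≤ √n := Real.sqrt_le_sqrt hι'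
    calc ∑ i, |(round (y i / g) : ℝ)| ≤ ∑ i, (|y i| / g + 1 / 2) :=
          sum_le_sum fun i _ => abs_round_div_le _ _ hg0
      _ = (∑ i, |y i|) / g + Fintype.card ι * (1 / 2) := by
          rw [sum_add_distrib, sum_div, sum_const, card_univ, nsmul_eq_mul]
      _ ≤ √n / g + n * (1 / 2) := by gcongr; linarith
      _ = n * (1 / β + 1 / 2) := by
          rw [hg, div_div_eq_mul_div, Real.mul_self_sqrt hn'.le]
          ring
  · calc ∑ i, (y i - g * round (y i / g)) ^ 2 ≤ ∑ _i : ι, g ^ 2 / 4 :=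
          sum_le_sum fun i _ => sq_sub_mul_round_le _ _ hg0
      _ = g ^ 2 * Fintype.card ι / 4 := by
          rw [sum_const, card_univ, nsmul_eq_mul]; ring
      _ ≤ _ := by linarith [show 0 ≤ g ^ 2 * (Fintype.card ι : ℝ) by positivity]

/-! ### Blocks with bounded least common denominator: net and representation. -/

set_option maxHeartbeats 1000000 in
/-- The points of the form `s (p + e)` with `p` an integer vector and `e` small have a small net. -/
theorem exists_lattice_net (ι : Type*) [Fintype ι] [Nonempty ι] (β τ σ a D : ℝ) (hβ : 0 < β)
    (hτ : 0 < τ) (hτ1 : τ < 1) (hσ : 0 < σ) (ha : 0 < a) (hD : 1 ≤ D) (hβD : 1 / β ≤ 2 * D) :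
    ∃ F : Finset (ι → ℝ),
      (#F : ℝ) ≤ D ^ 2 * (80 / τ * Real.exp 2 * (1 / a + 4) * (16 / τ) *
        (D / √(Fintype.card ι))) ^ Fintype.card ι ∧
      ∀ (y : ι → ℝ) (s θ : ℝ) (p : ι → ℤ) (e : ι → ℝ), (∀ i, y i = s * (p i + e i)) →
        1 ≤ θ → θ ≤ 3 * D → a * √(Fintype.card ι) ≤ θ → ∑ i, (p i + e i) ^ 2 ≤ θ ^ 2 →
        ∑ i, e i ^ 2 ≤ θ ^ 2 → ∑ i, e i ^ 2 ≤ (2 * β * D) ^ 2 → 0 ≤ s →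
        s * θ ≤ σ * √(Fintype.card ι) →
        ∃ w ∈ F, ∑ i, (y i - w i) ^ 2 ≤ (β * τ * σ) ^ 2 * Fintype.card ι := by
  classical
  set N := Fintype.card ι with hN
  have hN1 : 1 ≤ N := Fintype.card_pos
  have hN0 : (0 : ℝ) < N := by exact_mod_cast hN1
  set q : ℝ := √(N : ℝ) with hq
  have hq0 : 0 < q := Real.sqrt_pos.2 hN0
  have hqq : q * q = N := Real.mul_self_sqrt hN0.le
  -- The scale k + 1 stands for ⌈θ⌉. The radii N ρ₁ and N ρ₂ bound the ℓ¹ norms of p (where ‖p‖₂ ≤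
  -- 2θ) and of e rounded to multiples of `g k`.
  set ρ₁ : ℕ → ℝ := fun k => 2 * (k + 1) / q
  set ρ₂ : ℕ → ℝ := fun k => 4 * D / (τ * (k + 1)) + 1 / 2
  choose P hP hPc using fun k : ℕ =>
    exists_finset_int_of_sum_abs_le ι N (ρ₁ k) (by positivity)
  choose E hE hEc using fun k : ℕ =>
    exists_finset_int_of_sum_abs_le ι N (ρ₂ k) (by positivity)
  -- `g` is the mesh for e and `h` the mesh for s. They are tuned so that the two squared errors are
  -- at most 1/2 and 4/9 of the permitted (βτσ)²N.
  set g : ℕ → ℝ := fun k => β * τ * (k + 1) / 2 / q with hg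
  have hg0 : ∀ k, 0 < g k := fun k => by positivity
  set h : ℕ → ℝ := fun k => β * τ * σ * q / (3 * (k + 1) * (1 + β)) with hh
  have hh0 : ∀ k, 0 < h k := fun k => by positivity
  set M : ℕ := ⌊18 * D / τ⌋₊ + 1 with hM
  set A : Finset ℕ := {k ∈ range ⌈3 * D⌉₊ | a * q ≤ k + 1}
  refine ⟨A.biUnion fun k => (range M ×ˢ P k ×ˢ E k).image fun x i =>
    x.1 * h k * (x.2.1 i + g k * x.2.2 i), ?_, ?_⟩
  · have hMb : (M : ℝ) ≤ 20 * D / τ := by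
      have h1 : (⌊18 * D / τ⌋₊ : ℝ) ≤ 18 * D / τ := Nat.floor_le (by positivity)
      have h2 : 1 ≤ 2 * D / τ := by rw [le_div_iff₀ hτ]; linarith
      have h3 : 20 * D / τ = 18 * D / τ + 2 * D / τ := by ring
      rw [hM]; push_cast; linarith
    have hAb : (#A : ℝ) ≤ 4 * D := by
      have h1 : #A ≤ ⌈3 * D⌉₊ := (card_filter_le _ _).trans (by simp)
      have h2 := Nat.ceil_lt_add_one (a := 3 * D) (by positivity)
      have h3 : (#A : ℝ) ≤ ⌈3 * D⌉₊ := by exact_mod_cast h1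
      linarith
    have hk : ∀ k ∈ A, ((#((range M ×ˢ P k ×ˢ E k).image fun x i =>
        (x.1 * h k * (x.2.1 i + g k * x.2.2 i) : ℝ)) : ℕ) : ℝ) ≤
        20 * D / τ * (Real.exp 2 * (1 / a + 4) * (16 / τ) * (D / q)) ^ N := by
      intro k hkA
      obtain ⟨hk1, hk2⟩ := mem_filter.1 hkA
      have hk3 : ((k : ℝ) + 1) ≤ 4 * D := by
        have h2 := Nat.ceil_lt_add_one (a := 3 * D) (by positivity)
        have h3 : ((k : ℝ) + 1) ≤ ⌈3 * D⌉₊ := by exact_mod_cast mem_range.1 hk1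
        linarith
      have hk0 : (0 : ℝ) < k + 1 := by positivity
      have hc : ((#((range M ×ˢ P k ×ˢ E k).image fun x i =>
          (x.1 * h k * (x.2.1 i + g k * x.2.2 i) : ℝ)) : ℕ) : ℝ) ≤ M * (#(P k) * #(E k)) := by
        refine le_trans (Nat.cast_le.2 card_image_le) (le_of_eq ?_)
        simp [card_product]
      -- The lower bound a√N ≤ k + 1 absorbs the summand 1. The factor k + 1 on the right cancels
      -- against the 1/(k + 1) in the bound for ρ₂.
      have h1 : 1 + 2 * ρ₁ k ≤ (1 / a + 4) * ((k + 1) / q) := by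
        have : 1 ≤ 1 / a * ((k + 1) / q) := by
          rw [one_div_mul_eq_div, le_div_iff₀ ha, le_div_iff₀ hq0]; linarith
        have e : 2 * ρ₁ k = 4 * ((k + 1) / q) := by simp only [ρ₁]; ring
        linarith
      have h2 : 1 + 2 * ρ₂ k ≤ 16 / τ * (D / (k + 1)) := by
        have e : 16 / τ * (D / (k + 1)) = 8 * D / (τ * (k + 1)) + 8 * D / (τ * (k + 1)) := by
          field_simp; ring
        have e2 : 1 + 2 * ρ₂ k = 2 + 8 * D / (τ * (k + 1)) := by simp only [ρ₂]; ring
        have : 2 ≤ 8 * D / (τ * (k + 1)) := by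
          rw [le_div_iff₀ (by positivity)]; nlinarith
        linarith
      have hPb := (hPc k).trans (mul_le_mul_of_nonneg_left
        (pow_le_pow_left₀ (by positivity) h1 N) (Real.exp_pos _).le)
      have hEb := (hEc k).trans (mul_le_mul_of_nonneg_left
        (pow_le_pow_left₀ (by positivity) h2 N) (Real.exp_pos _).le)
      refine hc.trans ?_
      calc (M : ℝ) * (#(P k) * #(E k)) ≤ 20 * D / τ *
            ((Real.exp N * ((1 / a + 4) * ((k + 1) / q)) ^ N) *
              (Real.exp N * (16 / τ * (D / (k + 1))) ^ N)) := by gcongr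
        _ = _ := by
          have e1 : Real.exp N = Real.exp 1 ^ N := by rw [← Real.exp_nat_mul]; simp
          have e2 : Real.exp 2 = Real.exp 1 * Real.exp 1 := by rw [← Real.exp_add]; norm_num
          rw [e1, e2, ← mul_pow, ← mul_pow, ← mul_pow]
          congr 2
          field_simp
    have hX : (0 : ℝ) ≤ Real.exp 2 * (1 / a + 4) * (16 / τ) * (D / q) := by positivity
    calc _ ≤ ((∑ k ∈ A, #((range M ×ˢ P k ×ˢ E k).image fun x i =>
        (x.1 * h k * (x.2.1 i + g k * x.2.2 i) : ℝ)) : ℕ) : ℝ) := by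
          exact_mod_cast card_biUnion_le
      _ ≤ #A * (20 * D / τ * (Real.exp 2 * (1 / a + 4) * (16 / τ) * (D / q)) ^ N) := by
          rw [Nat.cast_sum, ← nsmul_eq_mul]
          exact sum_le_card_nsmul _ _ _ hk
      _ ≤ 4 * D * (20 * D / τ * (Real.exp 2 * (1 / a + 4) * (16 / τ) * (D / q)) ^ N) := by
          gcongr
      _ = D ^ 2 * (80 / τ * (Real.exp 2 * (1 / a + 4) * (16 / τ) * (D / q)) ^ N) := by ring
      _ ≤ D ^ 2 * ((80 / τ) ^ N * (Real.exp 2 * (1 / a + 4) * (16 / τ) * (D / q)) ^ N) := by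
          gcongr
          refine le_self_pow₀ ?_ (by omega)
          rw [le_div_iff₀ hτ]; linarith
      _ = _ := by rw [← mul_pow]; congr 2; ring
  · intro y s θ p e hy hθ1 hθD hθa hpe he heR hs hsθ
    have hθ0 : 0 < θ := by linarith
    obtain ⟨k, hk⟩ : ∃ k : ℕ, ⌈θ⌉₊ = k + 1 :=
      Nat.exists_eq_succ_of_ne_zero (Nat.ceil_pos.2 hθ0).ne'
    have hkθ : θ ≤ k + 1 := by have := Nat.le_ceil θ; rw [hk] at this; exact_mod_cast this
    have hθk : (k : ℝ) + 1 ≤ 2 * θ := by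
      have := Nat.ceil_lt_add_one hθ0.le; rw [hk] at this; push_cast at this; linarith
    have hk0 : (0 : ℝ) < k + 1 := by positivity
    have hkA : k ∈ A := by
      refine mem_filter.2 ⟨mem_range.2 ?_, hθa.trans hkθ⟩
      have := Nat.ceil_le_ceil hθD
      omega
    have hpP : p ∈ P k := by
      refine hP k p ?_
      have h1 : ∑ i, (p i : ℝ) ^ 2 ≤ (2 * θ) ^ 2 := by
        calc ∑ i, (p i : ℝ) ^ 2 ≤ ∑ i, (2 * (p i + e i) ^ 2 + 2 * e i ^ 2) :=
              sum_le_sum fun i _ => by nlinarith [sq_nonneg (p i + e i + e i)]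
          _ ≤ _ := by rw [sum_add_distrib, ← mul_sum, ← mul_sum]; linarith
      refine (sum_abs_le_sqrt_card_mul _ (by positivity) h1).trans ?_
      rw [← hN, ← hq, ← hqq]
      have : q * q * ρ₁ k = q * (2 * (k + 1)) := by simp only [ρ₁]; field_simp
      rw [this]
      gcongr
    set z : ι → ℤ := fun i => round (e i / g k)
    have hzE : z ∈ E k := by
      refine hE k z ?_
      have h1 := sum_abs_le_sqrt_card_mul e (by positivity) heR
      calc ∑ i, |(z i : ℝ)| ≤ ∑ i, (|e i| / g k + 1 / 2) :=
            sum_le_sum fun i _ => abs_round_div_le _ _ (hg0 k)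
        _ = (∑ i, |e i|) / g k + N * (1 / 2) := by
            rw [sum_add_distrib, ← sum_div, sum_const, card_univ, nsmul_eq_mul]
        _ ≤ q * (2 * β * D) / g k + N * (1 / 2) := by
            have := hg0 k
            gcongr
        _ = N * ρ₂ k := by
            simp only [hg, ρ₂]
            rw [mul_add, ← hqq]
            field_simp
            ring
    have hze : ∑ i, (e i - g k * z i) ^ 2 ≤ (β * τ * (k + 1)) ^ 2 / 16 := by
      calc ∑ i, (e i - g k * z i) ^ 2 ≤ ∑ _i : ι, g k ^ 2 / 4 :=
            sum_le_sum fun i _ => sq_sub_mul_round_le _ _ (hg0 k)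
        _ = q * q * (g k ^ 2 / 4) := by rw [sum_const, card_univ, nsmul_eq_mul, hqq]
        _ = _ := by simp only [hg]; field_simp; ring
    set t : ℕ := ⌊s / h k⌋₊
    have hst : |s - t * h k| ≤ h k := by
      have h1 := Nat.floor_le (div_nonneg hs (hh0 k).le)
      have h2 := Nat.lt_floor_add_one (s / h k)
      rw [le_div_iff₀ (hh0 k)] at h1
      rw [div_lt_iff₀ (hh0 k)] at h2
      rw [abs_le]
      constructor <;> linarith [hh0 k]
    have htM : t ∈ range M := by
      refine mem_range.2 (Nat.lt_succ_of_le (Nat.floor_le_floor ?_))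
      rw [div_le_div_iff₀ (hh0 k) hτ]
      refine le_of_mul_le_mul_right ?_ hθ0
      have h1 : s * τ * θ ≤ τ * (σ * q) := by nlinarith
      refine h1.trans ?_
      -- This is where 1/β ≤ 2D enters: it keeps the number of values of s of order D/τ even for
      -- small β.
      have h2 : 1 + β ≤ 3 * D * β := by
        rw [div_le_iff₀ hβ] at hβD
        nlinarith
      have h3 : 18 * D * h k * θ = τ * (σ * q) * (6 * D * β * θ / ((k + 1) * (1 + β))) := by
        simp only [hh]; field_simp; ring
      rw [h3]
      refine le_mul_of_one_le_right (by positivity) ?_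
      rw [le_div_iff₀ (by positivity), one_mul]
      calc ((k : ℝ) + 1) * (1 + β) ≤ (2 * θ) * (3 * D * β) := by gcongr
        _ = _ := by ring
    refine ⟨_, mem_biUnion.2 ⟨k, hkA, mem_image_of_mem _
      (mk_mem_product htM (mk_mem_product hpP hzE))⟩, ?_⟩
    have hpz : ∑ i, (p i + g k * z i) ^ 2 ≤ 2 * (k + 1) ^ 2 * (1 + β) ^ 2 := by
      calc ∑ i, (p i + g k * z i) ^ 2
          ≤ ∑ i, (2 * (p i + e i) ^ 2 + 2 * (e i - g k * z i) ^ 2) :=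
            sum_le_sum fun i _ => by
              nlinarith [sq_nonneg (p i + e i + (e i - g k * z i))]
        _ ≤ 2 * θ ^ 2 + 2 * ((β * τ * (k + 1)) ^ 2 / 16) := by
            rw [sum_add_distrib, ← mul_sum, ← mul_sum]; linarith
        _ ≤ 2 * (k + 1) ^ 2 + 2 * (β * 1 * (k + 1)) ^ 2 := by
            have : 0 ≤ (β * 1 * ((k : ℝ) + 1)) ^ 2 := by positivity
            have h2 : (β * τ * (k + 1)) ^ 2 ≤ (β * 1 * ((k : ℝ) + 1)) ^ 2 := by gcongr
            have h3 : θ ^ 2 ≤ ((k : ℝ) + 1) ^ 2 := by gcongr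
            linarith
        _ ≤ _ := by
            have : 0 ≤ 4 * ((k : ℝ) + 1) ^ 2 * β := by positivity
            linarith
    have hs2 : s ^ 2 * (k + 1) ^ 2 ≤ 4 * σ ^ 2 * N := by
      have h1 : (s * (k + 1)) ^ 2 ≤ (2 * (σ * q)) ^ 2 := by
        have : s * (k + 1) ≤ 2 * (σ * q) := by nlinarith
        gcongr
      rw [← hqq]
      linarith
    have hd2 : (s - t * h k) ^ 2 ≤ h k ^ 2 := sq_le_sq' (abs_le.1 hst).1 (abs_le.1 hst).2
    calc ∑ i, (y i - t * h k * (p i + g k * z i)) ^ 2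
        ≤ ∑ i, (2 * s ^ 2 * (e i - g k * z i) ^ 2 +
            2 * (s - t * h k) ^ 2 * (p i + g k * z i) ^ 2) :=
          sum_le_sum fun i _ => by
            rw [hy]
            nlinarith [sq_nonneg (s * (e i - g k * z i) - (s - t * h k) * (p i + g k * z i))]
      _ = 2 * s ^ 2 * ∑ i, (e i - g k * z i) ^ 2 +
            2 * (s - t * h k) ^ 2 * ∑ i, (p i + g k * z i) ^ 2 := by
          rw [sum_add_distrib, ← mul_sum, ← mul_sum]
      _ ≤ 2 * s ^ 2 * ((β * τ * (k + 1)) ^ 2 / 16) +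
            2 * h k ^ 2 * (2 * (k + 1) ^ 2 * (1 + β) ^ 2) := by gcongr
      _ = (β * τ) ^ 2 / 8 * (s ^ 2 * (k + 1) ^ 2) + 4 / 9 * ((β * τ * σ) ^ 2 * (q * q)) := by
          simp only [hh]; field_simp; ring
      _ ≤ (β * τ) ^ 2 / 8 * (4 * σ ^ 2 * N) + 4 / 9 * ((β * τ * σ) ^ 2 * N) := by
          rw [hqq]; gcongr
      _ ≤ _ := by
          have : 0 ≤ (β * τ * σ) ^ 2 * (N : ℝ) := by positivity
          linarith

/-- The infimum need not be attained, so the bound 2D is relaxed to 3D. The condition θ > L is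
automatic, because log₊ vanishes below L and no distance is negative. -/
theorem exists_of_lcd_le {ι : Type*} [Fintype ι] (L D : ℝ) (hL : 1 ≤ L) (hD : 1 ≤ D)
    (x : EuclideanSpace ℝ ι) (hx : lcd L x ≤ 2 * D) :
    ∃ (θ : ℝ) (p : ι → ℤ), L < θ ∧ θ < 3 * D ∧
      ∑ i, (θ * x i - p i) ^ 2 < L ^ 2 * Real.log (θ / L) := by
  have hne0 : (integerPoints ι).Nonempty := ⟨0, fun i => ⟨0, by simp⟩⟩
  have hL0 : 0 < L := by linarith
  set N : ℝ := (Fintype.card ι : ℝ)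
  have hN0 : 0 ≤ N := Nat.cast_nonneg _
  have hne : {θ : ℝ | 0 < θ ∧ Metric.infDist (θ • x) (integerPoints ι) <
      L * √(Real.posLog (θ / L))}.Nonempty := by
    -- The set must be nonempty for `sInf` to be a genuine infimum. At this θ, log₊(θ/L) = N + 1,
    -- while coordinatewise rounding gives squared distance at most N.
    refine ⟨L * Real.exp (N + 1), by positivity, ?_⟩
    rw [Metric.infDist_lt_iff hne0]
    refine ⟨WithLp.toLp 2 fun i => (round (L * Real.exp (N + 1) * x i) : ℝ),
      fun i => ⟨_, rfl⟩, ?_⟩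
    rw [mul_div_cancel_left₀ _ hL0.ne', Real.posLog, Real.log_exp, max_eq_right (by positivity),
      EuclideanSpace.dist_eq]
    refine lt_of_lt_of_le (Real.sqrt_lt_sqrt (sum_nonneg fun _ _ => sq_nonneg _) ?_)
      (le_mul_of_one_le_left (Real.sqrt_nonneg _) hL)
    refine lt_of_le_of_lt (sum_le_card_nsmul _ _ 1 fun i _ => ?_) ?_
    · rw [Real.dist_eq]
      have := abs_sub_round (L * Real.exp (N + 1) * x i)
      simp only [PiLp.smul_apply, smul_eq_mul]
      have h0 := abs_nonneg (L * Real.exp (N + 1) * x i - round (L * Real.exp (N + 1) * x i))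
      nlinarith
    · rw [card_univ, nsmul_eq_mul, mul_one]
      exact lt_add_one _
  obtain ⟨θ, ⟨hθ0, hθ⟩, hθD⟩ := exists_lt_of_csInf_lt hne (hx.trans_lt
    (by linarith : 2 * D < 3 * D))
  rw [Metric.infDist_lt_iff hne0] at hθ
  obtain ⟨z, hz, hdist⟩ := hθ
  choose p hp using hz
  have hLθ : L < θ := by
    by_contra hcon
    have h1 : Real.posLog (θ / L) = 0 := by
      rw [Real.posLog]
      exact max_eq_left (Real.log_nonpos (by positivity) (by rw [div_le_one hL0]; linarith))
    rw [h1, Real.sqrt_zero, mul_zero] at hdist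
    exact absurd dist_nonneg (not_le.2 hdist)
  have hlog : 0 ≤ Real.log (θ / L) := Real.log_nonneg (by rw [le_div_iff₀ hL0]; linarith)
  refine ⟨θ, p, hLθ, hθD, ?_⟩
  rw [Real.posLog, max_eq_right hlog] at hdist
  have h2 := pow_lt_pow_left₀ hdist dist_nonneg two_ne_zero
  rw [EuclideanSpace.dist_eq, Real.sq_sqrt (sum_nonneg fun _ _ => sq_nonneg _), mul_pow,
    Real.sq_sqrt hlog] at h2
  refine lt_of_le_of_lt (le_of_eq (sum_congr rfl fun i _ => ?_)) h2
  rw [Real.dist_eq, sq_abs, hp i]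
  simp

/-- A vector with comparable coordinates and a bounded least common denominator is a multiple of a
small perturbation of an integer vector. -/
theorem exists_repr_of_lcd_le {ι : Type*} [Fintype ι] [Nonempty ι] (L D σ μ : ℝ) (hL : 1 ≤ L)
    (hD : 1 ≤ D) (hσ : 0 < σ) (hμ : 0 < μ) (y : EuclideanSpace ℝ ι)
    (hy : ∀ i, μ ≤ |y i| ∧ |y i| ≤ σ) (hlcd : lcd L (‖y‖⁻¹ • y) ≤ 2 * D) :
    ∃ (s θ : ℝ) (p : ι → ℤ) (e : ι → ℝ), (∀ i, y i = s * (p i + e i)) ∧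
      1 ≤ θ ∧ θ ≤ 3 * D ∧ μ / (2 * σ) * √(Fintype.card ι) ≤ θ ∧ ∑ i, (p i + e i) ^ 2 ≤ θ ^ 2 ∧
      ∑ i, e i ^ 2 ≤ θ ^ 2 ∧ ∑ i, e i ^ 2 ≤ (2 * (L * √(Real.log (2 * D)) / D) * D) ^ 2 ∧ 0 ≤ s ∧
      s * θ ≤ σ * √(Fintype.card ι) := by
  obtain ⟨θ, p, hLθ, hθD, hp⟩ := exists_of_lcd_le L D hL hD _ hlcd
  have hL0 : 0 < L := by linarith
  have hθ0 : 0 < θ := by linarith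
  have hN0 : (0 : ℝ) < Fintype.card ι := by exact_mod_cast Fintype.card_pos
  set q : ℝ := √(Fintype.card ι : ℝ) with hq
  have hq0 : 0 < q := Real.sqrt_pos.2 hN0
  have hqq : q ^ 2 = Fintype.card ι := Real.sq_sqrt hN0.le
  have hYsq : ‖y‖ ^ 2 = ∑ i, y i ^ 2 := EuclideanSpace.real_norm_sq_eq y
  have hYσ : ‖y‖ ≤ σ * q := by
    refine le_of_sq_le_sq ?_ (by positivity)
    rw [hYsq, mul_pow, hqq]
    calc ∑ i, y i ^ 2 ≤ ∑ _i : ι, σ ^ 2 := sum_le_sum fun i _ => by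
          rw [← sq_abs]; exact pow_le_pow_left₀ (abs_nonneg _) (hy i).2 2
      _ = _ := by rw [sum_const, card_univ, nsmul_eq_mul, mul_comm]
  have hYμ : μ * q ≤ ‖y‖ := by
    refine le_of_sq_le_sq ?_ (by positivity)
    rw [hYsq, mul_pow, hqq]
    calc μ ^ 2 * (Fintype.card ι : ℝ) = ∑ _i : ι, μ ^ 2 := by
          rw [sum_const, card_univ, nsmul_eq_mul, mul_comm]
      _ ≤ ∑ i, y i ^ 2 := sum_le_sum fun i _ => by
          rw [← sq_abs (y i)]; exact pow_le_pow_left₀ hμ.le (hy i).1 2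
  have hY0 : 0 < ‖y‖ := lt_of_lt_of_le (by positivity) hYμ
  set x : ι → ℝ := fun i => ‖y‖⁻¹ * y i with hx
  have hx1 : ∑ i, (θ * x i) ^ 2 = θ ^ 2 := by
    simp_rw [hx, mul_pow]
    rw [← mul_sum, ← mul_sum, ← hYsq]
    field_simp
  have hp' : ∑ i, (θ * x i - p i) ^ 2 < L ^ 2 * Real.log (θ / L) := by
    simpa only [PiLp.smul_apply, smul_eq_mul] using hp
  have hlogt : L ^ 2 * Real.log (θ / L) ≤ θ ^ 2 := by
    have h1 := Real.log_le_sub_one_of_pos (div_pos hθ0 hL0)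
    calc L ^ 2 * Real.log (θ / L) ≤ L ^ 2 * (θ / L) := by gcongr; linarith
      _ = L * θ := by field_simp
      _ ≤ θ ^ 2 := by nlinarith
  have hlogD : 0 ≤ Real.log (2 * D) := Real.log_nonneg (by linarith)
  refine ⟨‖y‖ / θ, θ, p, fun i => θ * x i - p i, fun i => ?_, by linarith, hθD.le, ?_, ?_,
    hp'.le.trans hlogt, hp'.le.trans ?_, by positivity, ?_⟩
  · simp only [hx]
    field_simp
    ring
  -- For smaller θ every coordinate of θx is at most 1/2 in absolute value, so 0 is a nearest
  -- integer point and the squared distance is at least θ², contradicting L² log(θ/L) ≤ θ².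
  · by_contra! hcon
    have hsmall : ∀ i, |θ * x i| ≤ 1 / 2 := by
      intro i
      have h1 : |x i| ≤ σ / (μ * q) := by
        rw [hx, abs_mul, abs_of_pos (inv_pos.2 hY0), inv_mul_eq_div]
        exact div_le_div₀ hσ.le (hy i).2 (by positivity) hYμ
      rw [abs_mul, abs_of_pos hθ0]
      calc θ * |x i| ≤ μ / (2 * σ) * q * (σ / (μ * q)) := by gcongr
        _ = 1 / 2 := by field_simp
    have : θ ^ 2 ≤ ∑ i, (θ * x i - p i) ^ 2 := by
      rw [← hx1]
      refine sum_le_sum fun i _ => sq_le_sq.2 ?_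
      rcases eq_or_ne (p i) 0 with h0 | h0
      · simp [h0]
      · have h1 : (1 : ℝ) ≤ |(p i : ℝ)| := by exact_mod_cast Int.one_le_abs h0
        have h2 := abs_sub_abs_le_abs_sub (p i : ℝ) (θ * x i)
        rw [abs_sub_comm] at h2
        linarith [hsmall i]
    linarith
  · refine le_of_eq (Eq.trans (sum_congr rfl fun i _ => ?_) hx1)
    ring
  · have e : (2 * (L * √(Real.log (2 * D)) / D) * D) ^ 2 = L ^ 2 * (4 * Real.log (2 * D)) := by
      have : 2 * (L * √(Real.log (2 * D)) / D) * D = 2 * L * √(Real.log (2 * D)) := by field_simp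
      rw [this, mul_pow, Real.sq_sqrt hlogD]
      ring
    rw [e]
    gcongr
    -- θ/L ≤ 3D ≤ 4D², as L ≥ 1 and D ≥ 1.
    calc Real.log (θ / L) ≤ Real.log ((2 * D) ^ 2) := by
          refine Real.log_le_log (by positivity) ?_
          rw [div_le_iff₀ hL0]
          nlinarith [mul_le_mul hD hD zero_le_one (by linarith)]
      _ = 2 * Real.log (2 * D) := by rw [Real.log_pow]; norm_num
      _ ≤ _ := by linarith
  · rw [div_mul_cancel₀ _ hθ0.ne']
    exact hYσ

/-! ### The median and the majority of good blocks. -/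

/-- The median sits at zero-based index ⌊card/2⌋ of the sorted list, so it and all entries before it
make ⌊card/2⌋ + 1 elements. Taking the larger middle value is what makes this a strict majority. -/
theorem card_div_two_lt_countP_le_upperMedian (s : Multiset ℝ) (hs : 0 < s.card) :
    s.card / 2 < s.countP (· ≤ upperMedian s) := by
  set l := s.sort (· ≤ ·) with hl
  have hlen : l.length = s.card := Multiset.length_sort _
  have hlt : s.card / 2 < l.length := by rw [hlen]; omega
  have hmed : upperMedian s = l[s.card / 2] := by
    rw [upperMedian, ← hl, List.getD_eq_getElem _ _ hlt]
  have hsort : l.Pairwise (· ≤ ·) := Multiset.pairwise_sort _ _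
  have hs' : (l : Multiset ℝ) = s := Multiset.sort_eq _ _
  have h1 : (l.take (s.card / 2 + 1)).countP (fun x => decide (x ≤ upperMedian s)) =
      (l.take (s.card / 2 + 1)).length := by
    rw [List.countP_eq_length]
    intro a ha
    obtain ⟨i, hi, rfl⟩ := List.getElem_of_mem ha
    rw [List.length_take] at hi
    rw [List.getElem_take, hmed, decide_eq_true_iff]
    rcases (by omega : i < s.card / 2 ∨ i = s.card / 2) with h | h
    · exact List.pairwise_iff_getElem.1 hsort _ _ _ _ h
    · subst h; exact le_rfl
  have h2 := (List.take_sublist (s.card / 2 + 1) l).countP_le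
    (p := fun x => decide (x ≤ upperMedian s))
  rw [h1, List.length_take, min_eq_left (by omega)] at h2
  have h3 : s.countP (· ≤ upperMedian s) =
      l.countP (fun x => decide (x ≤ upperMedian s)) := by
    conv_lhs => rw [← hs']
    rw [Multiset.coe_countP]
    simp only [hs']
  omega

/-! ### Nets for single blocks and for families of good blocks. -/

/-- The base of the size of the net of a block. -/
noncomputable def blockConst (c₀ c₁ : ℝ) : ℝ :=
  80 / √c₀ * Real.exp 2 * (1 / (c₁ * √c₀ / (2 * √2)) + 4) * (16 / √c₀)

theorem one_le_blockConst (c₀ c₁ : ℝ) (hc₀ : c₀ ∈ Set.Ioo (0 : ℝ) 1) (hc₁ : 0 < c₁) :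
    1 ≤ blockConst c₀ c₁ := by
  have h0 : 0 < √c₀ := Real.sqrt_pos.2 hc₀.1
  have h1 : √c₀ ≤ 1 := Real.sqrt_le_one.2 hc₀.2.le
  have e1 : 1 ≤ 80 / √c₀ := by rw [le_div_iff₀ h0]; linarith
  have e2 : 1 ≤ 16 / √c₀ := by rw [le_div_iff₀ h0]; linarith
  have e3 : 1 ≤ Real.exp 2 := Real.one_le_exp (by norm_num)
  have e4 : 1 ≤ 1 / (c₁ * √c₀ / (2 * √2)) + 4 := by
    have : 0 ≤ 1 / (c₁ * √c₀ / (2 * √2)) := by positivity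
    linarith
  exact one_le_mul_of_one_le_of_one_le (one_le_mul_of_one_le_of_one_le
    (one_le_mul_of_one_le_of_one_le e1 e3) e4) e2

/-- The upper bound makes D/√log(2D) ≥ 1, so additive constants can be absorbed in it; it follows
from log(2D) ≤ 2D - 1 ≤ D². -/
theorem sqrt_log_two_mul_bounds (D : ℝ) (hD : 1 ≤ D) :
    1 / 2 ≤ √(Real.log (2 * D)) ∧ √(Real.log (2 * D)) ≤ D := by
  constructor
  · refine Real.le_sqrt_of_sq_le ?_
    have h1 : Real.log 2 ≤ Real.log (2 * D) := Real.log_le_log (by norm_num) (by linarith)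
    have := Real.log_two_gt_d9
    norm_num at this ⊢
    linarith
  · refine Real.sqrt_le_iff.2 ⟨by linarith, ?_⟩
    have := Real.log_le_sub_one_of_pos (show 0 < 2 * D by linarith)
    nlinarith [sq_nonneg (D - 1)]

theorem hasNet_block (c₀ c₁ : ℝ) (hc₀ : c₀ ∈ Set.Ioo (0 : ℝ) 1) (hc₁ : 0 < c₁) {n : ℕ}
    (hn : 0 < n) (L D : ℝ) (hL : 1 ≤ L) (hD : 1 ≤ D) (I : Finset (Fin n)) (hI : I.Nonempty)
    (V : Set (Fin n → ℝ))
    (hV : ∀ v ∈ V, (∀ i ∈ I, IsSpreadCoord c₀ c₁ (WithLp.toLp 2 v) i) ∧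
      lcd L (normalizedRestrict (WithLp.toLp 2 v) I) ≤ 2 * D) :
    HasNet I V (L * √(Real.log (2 * D)) / D / √n)
      (D ^ 2 * (blockConst c₀ c₁ * (D / √(#I))) ^ #I) := by
  have : Nonempty I := hI.to_subtype
  obtain ⟨hl1, hl2⟩ := sqrt_log_two_mul_bounds D hD
  have hn' : (0 : ℝ) < n := by exact_mod_cast hn
  have hc0 : 0 < c₀ := hc₀.1
  set ℓ := √(Real.log (2 * D)) with hℓ
  have hℓ0 : 0 < ℓ := by linarith
  have hτ : 0 < √c₀ := Real.sqrt_pos.2 hc0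
  have hτ1 : √c₀ < 1 := by rw [Real.sqrt_lt' one_pos]; simpa using hc₀.2
  have hβD : 1 / (L * ℓ / D) ≤ 2 * D := by
    rw [one_div_div, div_le_iff₀ (by positivity)]
    have : 1 / 2 ≤ L * ℓ := by nlinarith
    nlinarith
  -- With τ = √c₀ and σ = 1/√(c₀n), the error βτσ per coordinate is exactly β/√n, as in the grid
  -- net; a is half the ratio of the two spread bounds.
  obtain ⟨F, hF, hFn⟩ := exists_lattice_net I (L * ℓ / D) (√c₀) (1 / √(c₀ * n))
    (c₁ * √c₀ / (2 * √2)) D (by positivity) hτ hτ1 (by positivity) (by positivity) hD hβD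
  rw [Fintype.card_coe] at hF hFn
  refine HasNet.of_subtype ⟨F, hF, fun v hv => ?_⟩
  obtain ⟨hsp, hlcd⟩ := hV v hv
  set y : EuclideanSpace ℝ I := WithLp.toLp 2 fun i : I => v i
  obtain ⟨s, θ, p, e, h1, h2, h3, h4, h5, h6, h7, h8, h9⟩ :=
    exists_repr_of_lcd_le L D (1 / √(c₀ * n)) (c₁ / √(2 * n)) hL hD (by positivity)
      (by positivity) y (fun i => hsp i i.2) hlcd
  rw [Fintype.card_coe] at h4 h9
  have ha : c₁ / √(2 * n) / (2 * (1 / √(c₀ * n))) = c₁ * √c₀ / (2 * √2) := by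
    rw [Real.sqrt_mul (by norm_num), Real.sqrt_mul hc0.le]
    field_simp
  rw [ha] at h4
  obtain ⟨w, hw, hw'⟩ := hFn (fun i => v i) s θ p e h1 h2 h3 h4 h5 h6 h7 h8 h9
  refine ⟨w, hw, hw'.trans (le_of_eq ?_)⟩
  congr 2
  rw [Real.sqrt_mul hc0.le]
  field_simp

/-- Unit vectors with `m` disjoint blocks of size `r` of bounded least common denominator have a
small net. -/
theorem exists_net_of_good_blocks (c₀ c₁ : ℝ) (hc₀ : c₀ ∈ Set.Ioo (0 : ℝ) 1) (hc₁ : 0 < c₁)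
    {n T m r : ℕ} (hn : 0 < n) (hT : T ≤ n) (hr : 0 < r) (L D : ℝ) (hL : 1 ≤ L) (hD : 1 ≤ D)
    (block : Finset (Fin n) → Fin T → Finset (Fin n)) (V : Set (EuclideanSpace ℝ (Fin n)))
    (hV : ∀ v ∈ V, ‖v‖ = 1 ∧ ∃ S, (∀ j, #(block S j) = r) ∧
      (Pairwise fun i j => Disjoint (block S i) (block S j)) ∧
      ∃ J : Finset (Fin T), #J = m ∧ ∀ j ∈ J, (∀ i ∈ block S j, IsSpreadCoord c₀ c₁ v i) ∧
        lcd L (normalizedRestrict v (block S j)) ≤ 2 * D) :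
    ∃ N : Finset (EuclideanSpace ℝ (Fin n)), IsNet (L * √(Real.log (2 * D)) / D) V N ∧
      (#N : ℝ) ≤ D ^ (2 * m) *
        (20 * Real.exp 1 * blockConst c₀ c₁ * D / √(Real.log (2 * D))) ^ n *
        (√(Real.log (2 * D)) / √r) ^ (r * m) := by
  classical
  obtain ⟨hl1, hl2⟩ := sqrt_log_two_mul_bounds D hD
  have hK1 := one_le_blockConst c₀ c₁ hc₀ hc₁
  set K := blockConst c₀ c₁
  set ℓ := √(Real.log (2 * D)) with hℓ
  have hℓ0 : 0 < ℓ := by linarith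
  have hn' : (0 : ℝ) < n := by exact_mod_cast hn
  have hr' : (0 : ℝ) < r := by exact_mod_cast hr
  have hu1 : 1 ≤ D / ℓ := by rwa [le_div_iff₀ hℓ0, one_mul]
  set β := L * ℓ / D with hβ
  have hβ0 : 0 < β := by positivity
  have hβu : 1 / β ≤ D / ℓ := by
    rw [hβ, one_div_div]
    gcongr
    nlinarith
  set B : ℝ := D ^ (2 * m) * (5 * Real.exp 1 * K * (D / ℓ)) ^ n * (ℓ / √r) ^ (r * m) with hB
  have hpair : ∀ x : Finset (Fin n) × Finset (Fin T),
      ∃ F : Finset (Fin n → ℝ), (#F : ℝ) ≤ B ∧ ∀ v ∈ V,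
        ((∀ j, #(block x.1 j) = r) ∧
          (Pairwise fun i j => Disjoint (block x.1 i) (block x.1 j)) ∧ #x.2 = m ∧
          ∀ j ∈ x.2, (∀ i ∈ block x.1 j, IsSpreadCoord c₀ c₁ v i) ∧
            lcd L (normalizedRestrict v (block x.1 j)) ≤ 2 * D) →
        ∃ w ∈ F, ∑ i, (v i - w i) ^ 2 ≤ β ^ 2 := by
    rintro ⟨S, J⟩
    by_cases hS : (∀ j, #(block S j) = r) ∧
      (Pairwise fun i j => Disjoint (block S i) (block S j)) ∧ #J = m
    swap
    · exact ⟨∅, by rw [card_empty, Nat.cast_zero]; positivity,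
        fun v _ h => absurd ⟨h.1, h.2.1, h.2.2.1⟩ hS⟩
    obtain ⟨hS1, hS2, hJ⟩ := hS
    set W : Set (Fin n → ℝ) := {v | ∑ i, v i ^ 2 ≤ 1 ∧ ∀ j ∈ J,
      (∀ i ∈ block S j, IsSpreadCoord c₀ c₁ (WithLp.toLp 2 v) i) ∧
        lcd L (normalizedRestrict (WithLp.toLp 2 v) (block S j)) ≤ 2 * D} with hW
    have hblocks : HasNet (J.biUnion (block S)) W (β / √n) ((D ^ 2 * (K * (D / √r)) ^ r) ^ m) := by
      rw [← hJ]
      refine HasNet.biUnion J hS2 fun j hj => ?_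
      have := hasNet_block c₀ c₁ hc₀ hc₁ hn L D hL hD (block S j)
        (card_pos.1 (by rw [hS1]; exact hr)) W fun v hv => hv.2 j hj
      rwa [hS1] at this
    have hcard : #(J.biUnion (block S)) = r * m := by
      rw [card_biUnion fun i _ j _ hij => hS2 hij, sum_congr rfl fun j _ => hS1 j, sum_const, hJ,
        smul_eq_mul, mul_comm]
    have hrm : r * m ≤ n := by
      rw [← hcard]
      exact (card_le_univ _).trans (by simp)
    set R : Finset (Fin n) := (J.biUnion (block S))ᶜ
    have hRcard : #R = n - r * m := by rw [card_compl, hcard, Fintype.card_fin]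
    have hrest : HasNet R W (β / √n) (Real.exp n * (2 + 2 / β) ^ (n - r * m)) := by
      obtain ⟨F, hF, hFn⟩ := exists_grid_net R n hn
        (by rw [Fintype.card_coe, hRcard]; exact Nat.sub_le _ _) β hβ0
      rw [Fintype.card_coe] at hF hFn
      rw [hRcard] at hF
      refine HasNet.of_subtype ⟨F, hF, fun v hv => hFn (fun i => v i) (le_trans ?_ hv.1)⟩
      rw [sum_coe_sort R fun i => v i ^ 2]
      exact sum_le_sum_of_subset_of_nonneg (subset_univ _) fun _ _ _ => sq_nonneg _
    obtain ⟨F, hF, hFn⟩ := hblocks.union disjoint_compl_right hrest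
    rw [union_compl, card_univ, Fintype.card_fin] at hFn
    refine ⟨F, hF.trans ?_, fun v hv h => ?_⟩
    · have e1 : Real.exp n = Real.exp 1 ^ n := by rw [← Real.exp_nat_mul]; simp
      -- Splits the cost per block coordinate into the plain grid cost D/ℓ and the gain ℓ/√r.
      have e2 : D / √r = D / ℓ * (ℓ / √r) := by field_simp
      have h1 : 2 + 2 / β ≤ 5 * (D / ℓ) := by
        have : 2 / β = 2 * (1 / β) := by ring
        linarith
      calc (D ^ 2 * (K * (D / √r)) ^ r) ^ m * (Real.exp n * (2 + 2 / β) ^ (n - r * m))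
          ≤ (D ^ 2 * (K * (D / √r)) ^ r) ^ m * (Real.exp n * (5 * (D / ℓ)) ^ (n - r * m)) := by
            gcongr
        _ = D ^ (2 * m) * Real.exp 1 ^ n * (K ^ (r * m) * 5 ^ (n - r * m)) *
            ((D / ℓ) ^ (r * m) * (D / ℓ) ^ (n - r * m)) * (ℓ / √r) ^ (r * m) := by
            rw [e1, e2, mul_pow, ← pow_mul, ← pow_mul, mul_pow, mul_pow, mul_pow]
            ring
        _ ≤ D ^ (2 * m) * Real.exp 1 ^ n * (K ^ n * 5 ^ n) *
            ((D / ℓ) ^ (r * m) * (D / ℓ) ^ (n - r * m)) * (ℓ / √r) ^ (r * m) := by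
            gcongr
            · norm_num
            · exact Nat.sub_le _ _
        _ = B := by
            rw [← pow_add, Nat.add_sub_cancel' hrm, hB]
            simp only [mul_pow]
            ring
    · obtain ⟨w, hw, hw'⟩ := hFn v ⟨by
        rw [← EuclideanSpace.real_norm_sq_eq, (hV v hv).1, one_pow], h.2.2.2⟩
      refine ⟨w, hw, hw'.trans (le_of_eq ?_)⟩
      rw [div_pow, Real.sq_sqrt hn'.le]
      field_simp
  choose F hF hFn using hpair
  refine ⟨(univ.biUnion F).image (WithLp.toLp 2), fun v hv => ?_, ?_⟩
  · obtain ⟨-, S, h1, h2, J, h3, h4⟩ := hV v hv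
    obtain ⟨w, hw, hw'⟩ := hFn (S, J) v hv ⟨h1, h2, h3, h4⟩
    refine ⟨_, mem_image_of_mem _ (mem_biUnion.2 ⟨(S, J), mem_univ _, hw⟩), ?_⟩
    rw [EuclideanSpace.dist_eq]
    refine Real.sqrt_le_iff.2 ⟨hβ0.le, le_trans (le_of_eq ?_) hw'⟩
    exact sum_congr rfl fun i _ => by rw [Real.dist_eq, sq_abs]
  · have h1 : #((univ.biUnion F).image (WithLp.toLp 2)) ≤ ∑ x, #(F x) :=
      card_image_le.trans card_biUnion_le
    calc (#((univ.biUnion F).image (WithLp.toLp 2)) : ℝ) ≤ ((∑ x, #(F x) : ℕ) : ℝ) := by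
          exact_mod_cast h1
      _ ≤ #(univ : Finset (Finset (Fin n) × Finset (Fin T))) • B := by
          rw [Nat.cast_sum]
          exact sum_le_card_nsmul _ _ _ fun x _ => hF x
      _ = 2 ^ n * 2 ^ T * B := by
          rw [card_univ, Fintype.card_prod, Fintype.card_finset, Fintype.card_finset,
            Fintype.card_fin, Fintype.card_fin, nsmul_eq_mul]
          push_cast
          ring
      _ ≤ 2 ^ n * 2 ^ n * B := by
          have : 0 ≤ B := by positivity
          gcongr
          norm_num
      _ = _ := by
          rw [hB, show 20 * Real.exp 1 * K * D / ℓ = 2 * 2 * (5 * Real.exp 1 * K * (D / ℓ)) by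
            ring, mul_pow (2 * 2), mul_pow 2]
          ring

end MRLCD

/-! ### Choice of the number of blocks and the final bound. -/

theorem mainTheorem8 (c₀ c₁ : ℝ) (hc₀ : c₀ ∈ Set.Ioo (0 : ℝ) 1) (hc₁ : c₁ ∈ Set.Ioo (0 : ℝ) 1)
    (c : ℝ) (hc : MRLCD.IsSpreadConstant c₀ c₁ c) :
    ∃ C : ℝ, 0 < C ∧
      ∀ n : ℕ, 0 < n →
      ∀ lam ∈ Set.Ioo (C / n) (c / 2),
      ∀ spread : EuclideanSpace ℝ (Fin n) → Finset (Fin n),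
        MRLCD.IsSpreadAssignment n c₀ c₁ c spread →
      ∀ block : Finset (Fin n) → Fin (MRLCD.numBlocks n c lam) → Finset (Fin n),
        MRLCD.IsBlockAssignment n c lam block →
      ∀ L : ℝ, 1 ≤ L → ∀ D : ℝ, 1 ≤ D →
      ∃ N : Finset (EuclideanSpace ℝ (Fin n)),
        MRLCD.IsNet (L * √(Real.log (2 * D)) / D) (MRLCD.levelSet c₀ c₁ spread block L D) N ∧
        (#N : ℝ) ≤ D ^ (1 / lam) * (C * D / √(Real.log (2 * D))) ^ n *
          (√(Real.log (2 * D)) / √(lam * n)) ^ (c * n / 8) := by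
  have hK1 := MRLCD.one_le_blockConst c₀ c₁ hc₀ hc₁.1
  have hexp : 1 ≤ Real.exp 1 := Real.one_le_exp zero_le_one
  have hC1 : 1 ≤ 20 * Real.exp 1 * MRLCD.blockConst c₀ c₁ := by nlinarith
  refine ⟨20 * Real.exp 1 * MRLCD.blockConst c₀ c₁, by linarith, ?_⟩
  set C := 20 * Real.exp 1 * MRLCD.blockConst c₀ c₁
  intro n hn lam hlam
  set T := MRLCD.numBlocks n c lam with hT
  intro spread hspread block hblock L hL D hD
  obtain ⟨hc0, hc5, -⟩ := hc
  obtain ⟨hlam1, hlam2⟩ := hlam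
  have hn' : (0 : ℝ) < n := by exact_mod_cast hn
  obtain ⟨hl1, hl2⟩ := MRLCD.sqrt_log_two_mul_bounds D hD
  set ℓ := √(Real.log (2 * D))
  have hℓ0 : 0 < ℓ := by linarith
  have hlam0 : 0 < lam := lt_trans (by positivity) hlam1
  have hln1 : 1 < lam * n := by rw [div_lt_iff₀ hn'] at hlam1; linarith
  -- From 1 < λn < cn/2 < n/10.
  have hn10 : 10 < (n : ℝ) := by nlinarith
  set r := ⌈lam * n⌉₊ with hr
  have hr0 : 0 < r := Nat.ceil_pos.2 (by positivity)
  have hrl : lam * n ≤ r := Nat.le_ceil _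
  have hcl : c * n ≤ ⌈c * n⌉₊ := Nat.le_ceil _
  have hcu : (⌈c * n⌉₊ : ℝ) < c * n + 1 := Nat.ceil_lt_add_one (by positivity)
  have hTr : T * r ≤ ⌈c * n⌉₊ := Nat.div_mul_le_self _ _
  have hTr' : ⌈c * n⌉₊ < (T + 1) * r := by
    have := Nat.lt_mul_div_succ ⌈c * n⌉₊ hr0
    exact this.trans_eq (mul_comm _ _)
  have hT1 : 1 ≤ T := (Nat.le_div_iff_mul_le hr0).2 (by
    rw [one_mul]
    exact Nat.ceil_le_ceil (by nlinarith))
  have hTn : T ≤ n := by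
    have h1 : (⌈c * n⌉₊ : ℝ) ≤ n := by nlinarith
    have h2 : ⌈c * n⌉₊ ≤ n := by exact_mod_cast h1
    exact ((Nat.le_mul_of_pos_right T hr0).trans hTr).trans h2
  have hgood : ∀ m ≤ T / 2 + 1, ∀ v ∈ MRLCD.levelSet c₀ c₁ spread block L D,
      ‖v‖ = 1 ∧ ∃ S, (∀ j, #(block S j) = r) ∧
      (Pairwise fun i j => Disjoint (block S i) (block S j)) ∧
      ∃ J : Finset (Fin T), #J = m ∧ ∀ j ∈ J,
        (∀ i ∈ block S j, MRLCD.IsSpreadCoord c₀ c₁ v i) ∧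
        MRLCD.lcd L (MRLCD.normalizedRestrict v (block S j)) ≤ 2 * D := by
    classical
    intro m hm v hv
    obtain ⟨hvI, hvD⟩ := hv
    obtain ⟨hS, hSc⟩ := hspread v hvI
    obtain ⟨hb, hbd⟩ := hblock _ hS
    refine ⟨by simpa using hvI.1, spread v, fun j => (hb j).2, hbd, ?_⟩
    have h1 := MRLCD.card_div_two_lt_countP_le_upperMedian
      ((Finset.univ : Finset (Fin T)).val.map fun j =>
        MRLCD.lcd L (MRLCD.normalizedRestrict v (block (spread v) j))) (by
        rw [Multiset.card_map]
        exact hT1.trans_eq (by simp [hT]))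
    rw [Multiset.countP_map, Multiset.card_map] at h1
    have h2 : T / 2 < #{j : Fin T | MRLCD.lcd L (MRLCD.normalizedRestrict v (block (spread v) j)) ≤
        MRLCD.mrlcd spread block L v} := by
      refine lt_of_le_of_lt (le_of_eq ?_) h1
      simp [hT]
    obtain ⟨J, hJ, hJm⟩ := exists_subset_card_eq (hm.trans h2)
    exact ⟨J, hJm, fun j hj => ⟨fun i hi => hSc i ((hb j).1 hi),
      (mem_filter.1 (hJ hj)).2.trans hvD.2⟩⟩
  have hnet : ∀ m ≤ T / 2 + 1, _ := fun m hm =>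
    MRLCD.exists_net_of_good_blocks c₀ c₁ hc₀ hc₁.1 hn hTn hr0 L D hL hD block _ (hgood m hm)
  have hsq : 0 < √(lam * n) := Real.sqrt_pos.2 (by positivity)
  have hX : 0 ≤ (C * D / ℓ) ^ n := by positivity
  -- If the ratio is at least 1, its power only enlarges the target, and m = 0 (the grid alone)
  -- suffices. Otherwise a majority of blocks is used.
  rcases le_or_gt 1 (ℓ / √(lam * n)) with hq | hq
  · obtain ⟨N, hN, hNc⟩ := hnet 0 (Nat.zero_le _)
    refine ⟨N, hN, hNc.trans ?_⟩
    have h1 : 1 ≤ D ^ (1 / lam) := Real.one_le_rpow hD (by positivity)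
    have h2 : 1 ≤ (ℓ / √(lam * n)) ^ (c * n / 8) := Real.one_le_rpow hq (by positivity)
    simp only [mul_zero, pow_zero, one_mul, mul_one]
    calc (C * D / ℓ) ^ n = 1 * (C * D / ℓ) ^ n * 1 := by ring
      _ ≤ _ := by gcongr
  · obtain ⟨N, hN, hNc⟩ := hnet (T / 2 + 1) le_rfl
    refine ⟨N, hN, hNc.trans ?_⟩
    set m := T / 2 + 1 with hm
    have hmT : m ≤ T := by omega
    have hTm : T + 1 ≤ 2 * m := by omega
    -- 2mλn ≤ 2mr ≤ 2⌈cn⌉ < 2(cn + 1) ≤ n, by c < 1/5 and n > 10.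
    have h1 : D ^ (2 * m) ≤ D ^ (1 / lam) := by
      rw [← Real.rpow_natCast]
      refine Real.rpow_le_rpow_of_exponent_le hD ?_
      rw [le_div_iff₀ hlam0]
      refine le_of_mul_le_mul_right ?_ hn'
      have h2 : (m : ℝ) * r ≤ ⌈c * n⌉₊ := by
        exact_mod_cast (Nat.mul_le_mul_right r hmT).trans hTr
      have h3 : (m : ℝ) * (lam * n) ≤ m * r := by gcongr
      push_cast
      nlinarith
    have h2 : (ℓ / √r) ^ (r * m) ≤ (ℓ / √(lam * n)) ^ (c * n / 8) := by
      have h3 : ℓ / √r ≤ ℓ / √(lam * n) := by gcongr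
      refine (pow_le_pow_left₀ (by positivity) h3 _).trans ?_
      rw [← Real.rpow_natCast]
      -- The base is below 1, so a lower bound on rm is needed; 2m ≥ T + 1 gives 2rm ≥ ⌈cn⌉, more
      -- than the required cn/8.
      refine Real.rpow_le_rpow_of_exponent_ge (by positivity) hq.le ?_
      have h4 : ⌈c * n⌉₊ ≤ 2 * (r * m) := by
        have := Nat.mul_le_mul_right r hTm
        nlinarith
      have h5 : (⌈c * n⌉₊ : ℝ) ≤ 2 * ((r * m : ℕ) : ℝ) := by exact_mod_cast h4
      have : 0 < c * n := by positivity
      linarith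
    gcongr
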